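/- Let $(W,S)$ be a finite Coxeter system, let $E$ be its real reflection representation with its $W$-invariant canonical positive definite form, and let $T=\{wsw^{-1} : w\in W,\ s\in S\}$ be the set of reflections of $W$. For a subspace $V\subseteq E$ put $W_V=\{w\in W : w(v)=v \text{ for all } v\in V\}$; for $X\subseteq W$ put $\mathrm{Fix}(X)=\{v\in E : x(v)=v \text{ for all } x\in X\}$ and define the parabolic closure $\mathrm{cl}(X)=W_{\mathrm{Fix}(X)}$, writing $\mathrm{cl}(x)=\mathrm{cl}(\{x\})$. Let $R$ be a reflection subgroup of $W$, that is, a subgroup generated by a subset of $T$. A parabolic subgroup of $R$ is the pointwise stabilizer in $R$ of a subspace of $\mathrm{Fix}(R)^{\perp}$, the space that affords the reflection representation of $R$. A Coxeter element of $R$ is the product, in some order, of the elements of a Coxeter generating set $S'\subseteq R\cap T$ of $R$ (i.e. $S'$ consists of reflections and $(R,S')$ is a Coxeter system). (i) If $x\in R$ is not contained in any proper parabolic subgroup of $R$, then $\mathrm{cl}(x)=\mathrm{cl}(R)$. (ii) Consequently, if $V$ is a subspace of $E$ and $c$ is a Coxeter element of $R$ that is conjugate in $W$ to an element of $W_V$,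 then $R$ is conjugate in $W$ to a subgroup of $W_V$. -/

import Mathlib

namespace CoxeterMatrix

variable {B : Type*} (M : CoxeterMatrix B)

/-- The canonical symmetric bilinear form on the real vector space with basis `(e i)`, `i : B`:
`⟨e i, e j⟩ = - cos (π / M i j)`. The convention that `M i j = 0` encodes infinite order
gives the usual value `-1` in that case. -/
noncomputable def titsForm : LinearMap.BilinForm ℝ (B →₀ ℝ) :=
  Finsupp.linearCombination ℝ fun i =>
    Finsupp.linearCombination ℝ fun j => -Real.cos (Real.pi / (M i j : ℝ))

theorem titsForm_single_single (i j : B) :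
    M.titsForm (Finsupp.single i 1) (Finsupp.single j 1) = -Real.cos (Real.pi / (M i j : ℝ)) := by
  simp [titsForm]

theorem two_smul_titsForm_self (i : B) :
    ((2 : ℝ) • M.titsForm (Finsupp.single i 1)) (Finsupp.single i 1) = 2 := by
  simp [titsForm_single_single]

/-- The orthogonal reflection `v ↦ v - 2 ⟨e i, v⟩ e i` with root `e i`. -/
noncomputable def simpleReflection (i : B) : (B →₀ ℝ) ≃ₗ[ℝ] (B →₀ ℝ) :=
  Module.reflection (M.two_smul_titsForm_self i)

theorem simpleReflection_apply (i : B) (v : B →₀ ℝ) :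
    M.simpleReflection i v
      = v - (2 * M.titsForm (Finsupp.single i 1) v) • Finsupp.single i 1 := by
  simp [simpleReflection, Module.reflection_apply]

theorem simpleReflection_pow (i j : B) :
    (M.simpleReflection i * M.simpleReflection j) ^ M i j = 1 := by
  rcases eq_or_ne i j with rfl | hij
  · rw [M.diagonal, pow_one]
    ext1 v
    exact Module.involutive_reflection (M.two_smul_titsForm_self i) v
  rcases Nat.eq_zero_or_pos (M i j) with h0 | hpos
  · rw [h0, pow_zero]
  have h1 := M.off_diagonal i j hij
  have hfg : M.titsForm (Finsupp.single i 1) (Finsupp.single j 1) =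
      -Real.cos (Real.pi / (M i j : ℝ)) := M.titsForm_single_single i j
  have hgf : M.titsForm (Finsupp.single j 1) (Finsupp.single i 1) =
      -Real.cos (Real.pi / (M i j : ℝ)) := by
    rw [M.titsForm_single_single, M.symmetric]
  rcases (show M i j = 2 ∨ 3 ≤ M i j by omega) with h2 | h3
  · rw [h2] at hfg hgf ⊢
    have hc : Real.cos (Real.pi / ((2 : ℕ) : ℝ)) = 0 := by simp
    rw [hc, neg_zero] at hfg hgf
    have hi := M.two_smul_titsForm_self i
    have hj := M.two_smul_titsForm_self j
    simp only [LinearMap.smul_apply, smul_eq_mul] at hi hj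
    ext1 v
    simp only [pow_two, LinearEquiv.mul_apply, simpleReflection_apply, map_sub, map_smul,
      hfg, hgf]
    have hi1 : M.titsForm (Finsupp.single i 1) (Finsupp.single i 1) = 1 := by linarith
    have hj1 : M.titsForm (Finsupp.single j 1) (Finsupp.single j 1) = 1 := by linarith
    simp only [hi1, hj1, LinearEquiv.coe_one, id_eq]
    module
  · have hm0 : (M i j : ℝ) ≠ 0 := by positivity
    have hm3 : (3 : ℝ) ≤ (M i j : ℝ) := by exact_mod_cast h3
    set θ : ℝ := 2 * (Real.pi / (M i j : ℝ)) with hθ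
    have ht : 2 * Real.cos θ = ((2 : ℝ) • M.titsForm (Finsupp.single i 1)) (Finsupp.single j 1)
        * ((2 : ℝ) • M.titsForm (Finsupp.single j 1)) (Finsupp.single i 1) - 2 := by
      simp only [LinearMap.smul_apply, smul_eq_mul, hfg, hgf]
      rw [hθ, Real.cos_two_mul]
      ring
    have hsin : Real.sin θ ≠ 0 := by
      have hp : 0 < Real.pi / (M i j : ℝ) := by positivity
      have hlt : Real.pi / (M i j : ℝ) ≤ Real.pi / 3 := by gcongr
      have := Real.pi_pos
      exact (Real.sin_pos_of_pos_of_lt_pi (by linarith) (by linarith)).ne'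
    have hmθ : (M i j : ℝ) * θ = 2 * Real.pi := by
      rw [hθ]; field_simp
    have hS := Polynomial.Chebyshev.S_two_mul_real_cos θ
    ext1 v
    have key := Module.reflection_mul_reflection_pow_apply (M.two_smul_titsForm_self i)
      (M.two_smul_titsForm_self j) (M i j) v (2 * Real.cos θ) ht
    rw [simpleReflection, simpleReflection, key]
    clear key
    obtain ⟨k, hk | hk⟩ : ∃ k : ℤ, (M i j : ℤ) = 2 * k ∨ (M i j : ℤ) = 2 * k + 1 :=
      ⟨(M i j : ℤ) / 2, by omega⟩
    · have e1 : ((M i j : ℤ) - 2) / 2 = k - 1 := by omega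
      have e2 : ((M i j : ℤ) - 1) / 2 = k - 1 := by omega
      have hkr : (M i j : ℝ) = 2 * k := by exact_mod_cast hk
      have hz : (Polynomial.Chebyshev.S ℝ (k - 1)).eval (2 * Real.cos θ) = 0 := by
        have h := hS (k - 1)
        have : (((k - 1 : ℤ) : ℝ) + 1) * θ = Real.pi := by
          push_cast
          rw [hkr] at hmθ
          linarith
        rw [this, Real.sin_pi] at h
        exact (mul_eq_zero.mp h).resolve_right hsin
      rw [e1, e2, hz]
      simp
    · have e1 : ((M i j : ℤ) - 2) / 2 = k - 1 := by omega
      have e2 : ((M i j : ℤ) - 1) / 2 = k := by omega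
      have e3 : ((M i j : ℤ) - 3) / 2 = k - 1 := by omega
      have e4 : (M i j : ℤ) / 2 = k := by omega
      have hkr : (M i j : ℝ) = 2 * k + 1 := by exact_mod_cast hk
      have hz : (Polynomial.Chebyshev.S ℝ k).eval (2 * Real.cos θ)
          + (Polynomial.Chebyshev.S ℝ (k - 1)).eval (2 * Real.cos θ) = 0 := by
        have ha := hS k
        have hb := hS (k - 1)
        have e : ((k : ℝ) + 1) * θ = 2 * Real.pi - (((k - 1 : ℤ) : ℝ) + 1) * θ := by
          push_cast
          rw [hkr] at hmθ
          linarith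
        rw [e, Real.sin_two_pi_sub] at ha
        refine (mul_eq_zero.mp (?_ : _ * Real.sin θ = 0)).resolve_right hsin
        rw [add_mul, ha, hb]
        ring
      rw [e1, e2, e3, e4, hz]
      simp

theorem isLiftable_simpleReflection :
    M.IsLiftable fun i => (M.simpleReflection i : (B →₀ ℝ) →ₗ[ℝ] (B →₀ ℝ)) := by
  intro i j
  have h := congrArg (fun e : (B →₀ ℝ) ≃ₗ[ℝ] (B →₀ ℝ) => (e : (B →₀ ℝ) →ₗ[ℝ] (B →₀ ℝ)))
    (M.simpleReflection_pow i j)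
  have hmul (a b : (B →₀ ℝ) ≃ₗ[ℝ] (B →₀ ℝ)) :
      ((a * b : (B →₀ ℝ) ≃ₗ[ℝ] (B →₀ ℝ)) : (B →₀ ℝ) →ₗ[ℝ] (B →₀ ℝ)) = a * b := rfl
  have hpow (a : (B →₀ ℝ) ≃ₗ[ℝ] (B →₀ ℝ)) (n : ℕ) :
      ((a ^ n : (B →₀ ℝ) ≃ₗ[ℝ] (B →₀ ℝ)) : (B →₀ ℝ) →ₗ[ℝ] (B →₀ ℝ))
        = (a : (B →₀ ℝ) →ₗ[ℝ] (B →₀ ℝ)) ^ n := by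
    induction n with
    | zero => rfl
    | succ n ih => rw [pow_succ, pow_succ, hmul, ih]
  simp only [hpow, hmul] at h
  exact h

end CoxeterMatrix

/-- A subset `S` of a group `G` is a Coxeter generating set if `G` has a Coxeter system whose
simple reflections are precisely the elements of `S` (each indexed by itself). -/
def IsCoxeterGeneratingSet {G : Type*} [Group G] (S : Set G) : Prop :=
  ∃ (M : CoxeterMatrix S) (cs : CoxeterSystem M G), ∀ s : S, cs.simple s = (s : G)

namespace CoxeterSystem

variable {B W : Type*} [Group W] {M : CoxeterMatrix B} (cs : CoxeterSystem M W)

/-- The real reflection representation `E` of `W`: the simple generator indexed by `i` acts as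
`v ↦ v - 2 ⟨e i, v⟩ e i` on the space with basis `(e i)`, `i : B`. -/
noncomputable def reflectionRep : Representation ℝ W (B →₀ ℝ) :=
  cs.lift ⟨fun i => (M.simpleReflection i : (B →₀ ℝ) →ₗ[ℝ] (B →₀ ℝ)),
    M.isLiftable_simpleReflection⟩

theorem reflectionRep_simple (i : B) (v : B →₀ ℝ) :
    cs.reflectionRep (cs.simple i) v
      = v - (2 * M.titsForm (Finsupp.single i 1) v) • Finsupp.single i 1 := by
  rw [reflectionRep, cs.lift_apply_simple]
  exact M.simpleReflection_apply i v

/-- The pointwise stabilizer `W_V` of a subspace `V` of the reflection representation. The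
parabolic subgroups of `W` are the subgroups of this form. -/
def parabolicSubgroup (V : Submodule ℝ (B →₀ ℝ)) : Subgroup W where
  carrier := {w | ∀ v ∈ V, cs.reflectionRep w v = v}
  one_mem' := by simp
  mul_mem' := by
    intro a b ha hb v hv
    rw [map_mul, Module.End.mul_apply, hb v hv, ha v hv]
  inv_mem' := by
    intro a ha v hv
    conv_lhs => rw [← ha v hv]
    rw [← Module.End.mul_apply, ← map_mul, inv_mul_cancel, map_one, Module.End.one_apply]

/-- `Fix(X)`: the vectors of the reflection representation fixed by all elements of `X`. -/
def fixedSpace (X : Set W) : Submodule ℝ (B →₀ ℝ) where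
  carrier := {v | ∀ x ∈ X, cs.reflectionRep x v = v}
  zero_mem' := by simp
  add_mem' := by
    intro a b ha hb x hx
    rw [map_add, ha x hx, hb x hx]
  smul_mem' := by
    intro c a ha x hx
    rw [map_smul, ha x hx]

/-- The parabolic closure `W_{Fix(X)}` of a subset `X` of `W`. -/
def parabolicClosure (X : Set W) : Subgroup W :=
  cs.parabolicSubgroup (cs.fixedSpace X)

/-- A reflection subgroup of `W` is a subgroup generated by a set of reflections of `W`. -/
def IsReflectionSubgroup (R : Subgroup W) : Prop :=
  ∃ Y : Set W, (∀ t ∈ Y, cs.IsReflection t) ∧ R = Subgroup.closure Y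

/-- `P` is a parabolic subgroup of the reflection subgroup `R`, regarded as a reflection group in
its own right: the space affording the reflection representation of `R` is the orthogonal
complement of `Fix(R)`, and `P` is the pointwise stabilizer in `R` of a subspace of it.
(The canonical form is invariant under `W` and, `W` being finite, positive definite.) -/
def IsParabolicSubgroupOf (P R : Subgroup W) : Prop :=
  ∃ U : Submodule ℝ (B →₀ ℝ), U ≤ M.titsForm.orthogonal (cs.fixedSpace (R : Set W)) ∧
    P = R ⊓ cs.parabolicSubgroup U

/-- `c` is a Coxeter element of the reflection subgroup `R`: the product, in some order, of the
elements of a Coxeter generating set of `R` consisting of reflections. -/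
def IsCoxeterElementOf (c : W) (R : Subgroup W) : Prop :=
  ∃ l : List R, l.Nodup ∧ IsCoxeterGeneratingSet {r : R | r ∈ l} ∧
    (∀ r ∈ l, cs.IsReflection (r : W)) ∧ c = (l.prod : R)

end CoxeterSystem

/-! Everything reduces to comparing fixed spaces, since a parabolic closure depends only on the
fixed space.

For (i), let `U` be the part of `Fix(x)` orthogonal to `Fix(R)`. Its stabilizer in `R` is parabolic
in `R` and contains `x`, hence is all of `R`, so `U` lies in `Fix(R)`. Averaging over `R` splits any
vector of `Fix(x)` into one in `Fix(R)` and one in `U`, whence `Fix(x) = Fix(R)`.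

For (ii), the inclusion of `Fix(c)` in `Fix(R)` is proved directly, without passing through (i). A
product of reflections with linearly independent roots fixes only what every factor fixes
(`reflectionRep_eq_of_list_prod`). Independence for a Coxeter generating set of `R`
(`linearIndependent_of_isUnitRoot`) comes from comparing the Gram matrix of the roots with the
canonical form of the abstract Coxeter group `R`. This needs that form to be positive definite
(`titsForm_self_pos`), and the representation of `W` to be faithful (`reflectionRep_injective`) so
that distinct reflections have non-proportional roots. -/

namespace CoxeterMatrix

variable {B : Type*} (M : CoxeterMatrix B)

/-! ### The canonical form: symmetry, invariance, positive definiteness. -/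

theorem titsForm_comm (v w : B →₀ ℝ) : M.titsForm v w = M.titsForm w v := by
  induction v using Finsupp.induction_linear with
  | zero => simp
  | add v v' h h' => simp [h, h']
  | single i a =>
    induction w using Finsupp.induction_linear with
    | zero => simp
    | add w w' h h' => simp only [map_add, LinearMap.add_apply, h, h']
    | single j b =>
      rw [← mul_one a, ← mul_one b, ← smul_eq_mul, ← smul_eq_mul, ← Finsupp.smul_single,
        ← Finsupp.smul_single]
      simp only [map_smul, LinearMap.smul_apply, titsForm_single_single, M.symmetric i j,
        smul_eq_mul]
      ring

theorem titsForm_single_self (i : B) :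
    M.titsForm (Finsupp.single i 1) (Finsupp.single i 1) = 1 := by
  simp [titsForm_single_single]

end CoxeterMatrix

/-- The powers of a product of two reflections, computed on the plane spanned by their roots. -/
theorem sin_smul_reflection_mul_reflection_pow {V : Type*} [AddCommGroup V] [Module ℝ V]
    {f g : V →ₗ[ℝ] V} {x y : V} {θ : ℝ} (hfx : f x = -x) (hfy : f y = y + (2 * Real.cos θ) • x)
    (hgy : g y = -y) (hgx : g x = x + (2 * Real.cos θ) • y) (k : ℕ) :
    Real.sin θ • ((f * g) ^ k) x
      = Real.sin ((2 * k + 1 : ℝ) * θ) • x + Real.sin ((2 * k : ℝ) * θ) • y := by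
  induction k with
  | zero => simp
  | succ k ih =>
    have key (a : ℝ) : Real.sin (a + θ + θ) = 2 * Real.cos θ * Real.sin (a + θ) - Real.sin a := by
      have h : a = (a + θ) - θ := by ring
      rw [Real.sin_add (a + θ) θ]
      nth_rw 4 [h]
      rw [Real.sin_sub]
      ring
    have h1 := key (2 * k * θ)
    have h2 := key (2 * k * θ + θ)
    rw [pow_succ', Module.End.mul_apply, ← map_smul, ih, Module.End.mul_apply]
    have e1 : ((2 * k + 1 : ℝ) * θ) = 2 * k * θ + θ := by ring
    have e2 : ((2 * ((k + 1 : ℕ) : ℝ)) * θ) = 2 * k * θ + θ + θ := by push_cast; ring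
    have e3 : ((2 * ((k + 1 : ℕ) : ℝ) + 1) * θ) = 2 * k * θ + θ + θ + θ := by push_cast; ring
    rw [e1, e2, e3, h2, h1]
    simp only [map_add, map_smul, map_neg, hgx, hgy, hfx, hfy, smul_add, smul_neg]
    module

namespace CoxeterSystem

variable {B W : Type*} [Group W] {M : CoxeterMatrix B}

theorem titsForm_reflectionRep (cs : CoxeterSystem M W) (w : W) (u v : B →₀ ℝ) :
    M.titsForm (cs.reflectionRep w u) (cs.reflectionRep w v) = M.titsForm u v := by
  induction w using cs.simple_induction_left with
  | one => simp
  | mul_simple_left w i ih =>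
    rw [← ih, map_mul, Module.End.mul_apply, Module.End.mul_apply, reflectionRep_simple,
      reflectionRep_simple]
    simp only [map_sub, map_smul, LinearMap.sub_apply, LinearMap.smul_apply, smul_eq_mul,
      M.titsForm_single_self, M.titsForm_comm _ (Finsupp.single i 1)]
    ring

theorem reflectionRep_simple_single_self (cs : CoxeterSystem M W) (i : B) :
    cs.reflectionRep (cs.simple i) (Finsupp.single i 1) = -Finsupp.single i 1 := by
  rw [reflectionRep_simple, M.titsForm_single_self]
  module

theorem reflectionRep_simple_single (cs : CoxeterSystem M W) (i j : B) :
    cs.reflectionRep (cs.simple i) (Finsupp.single j 1)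
      = Finsupp.single j 1 + (2 * Real.cos (Real.pi / (M i j : ℝ))) • Finsupp.single i 1 := by
  rw [reflectionRep_simple, M.titsForm_single_single]
  module

theorem simple_injective (cs : CoxeterSystem M W) : Function.Injective cs.simple := by
  intro i j h
  by_contra hij
  have h1 := cs.reflectionRep_simple_single_self i
  rw [h, reflectionRep_simple_single] at h1
  have := DFunLike.congr_fun h1 i
  simp [Ne.symm hij] at this
  norm_num at this

theorem finite_index (cs : CoxeterSystem M W) [Finite W] : Finite B :=
  Finite.of_injective _ cs.simple_injective

/-- The canonical form of a finite Coxeter group is positive definite. -/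
theorem titsForm_self_pos (cs : CoxeterSystem M W) [Finite W] {v : B →₀ ℝ} (hv : v ≠ 0) : 0 < M.titsForm v v := by
  have := cs.finite_index
  have := Fintype.ofFinite B
  have := Fintype.ofFinite W
  -- `Φ` lists the coordinates of all `W`-translates, so `Φ u ⬝ᵥ Φ v` is the standard inner product
  -- summed over `W`: invariant and positive definite.
  let Φ : (B →₀ ℝ) →ₗ[ℝ] (W × B → ℝ) :=
    LinearMap.pi fun p => Finsupp.lapply p.2 ∘ₗ cs.reflectionRep p.1
  have hΦ (v : B →₀ ℝ) (p : W × B) : Φ v p = cs.reflectionRep p.1 v p.2 := rfl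
  have hΦ0 {v : B →₀ ℝ} (h : Φ v = 0) : v = 0 := by
    ext i
    simpa [hΦ] using congrFun h (1, i)
  have hpos {v : B →₀ ℝ} (h : v ≠ 0) : 0 < Φ v ⬝ᵥ Φ v := by
    refine lt_of_le_of_ne (Finset.sum_nonneg fun p _ => mul_self_nonneg _) fun h0 => h (hΦ0 ?_)
    exact dotProduct_self_eq_zero.mp h0.symm
  have hinv (g : W) (u v : B →₀ ℝ) :
      Φ (cs.reflectionRep g u) ⬝ᵥ Φ (cs.reflectionRep g v) = Φ u ⬝ᵥ Φ v := by
    refine Fintype.sum_equiv ((Equiv.mulRight g).prodCongr (Equiv.refl B)) _ _ fun p => ?_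
    simp [hΦ]
  -- Invariance under the `i`-th simple reflection forces the averaged form to agree with the
  -- canonical one against `e i`, up to the scalar `c i`.
  have hform (i : B) (v : B →₀ ℝ) :
      Φ (Finsupp.single i 1) ⬝ᵥ Φ v
        = M.titsForm (Finsupp.single i 1) v
          * (Φ (Finsupp.single i 1) ⬝ᵥ Φ (Finsupp.single i 1)) := by
    have h := hinv (cs.simple i) (Finsupp.single i 1) v
    rw [reflectionRep_simple_single_self, reflectionRep_simple] at h
    simp only [map_neg, map_sub, map_smul, neg_dotProduct, dotProduct_sub, dotProduct_smul,
      smul_eq_mul] at h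
    linarith
  set c : B → ℝ := fun i => Φ (Finsupp.single i 1) ⬝ᵥ Φ (Finsupp.single i 1) with hc
  have hcpos (i : B) : 0 < c i := hpos (by simp)
  have hsq (i : B) : √(c i) * √(c i) = c i := Real.mul_self_sqrt (hcpos i).le
  have hsqpos (i : B) : 0 < √(c i) := Real.sqrt_pos.mpr (hcpos i)
  -- By symmetry `c i = c j` whenever `e i` and `e j` are not orthogonal, so rescaling each `e i` by
  -- `(√(c i))⁻¹` turns the averaged form into the canonical one.
  have hgram (i j : B) : M.titsForm (Finsupp.single i 1) (Finsupp.single j 1)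
      = (√(c i))⁻¹ * ((√(c j))⁻¹ * (Φ (Finsupp.single i 1) ⬝ᵥ Φ (Finsupp.single j 1))) := by
    have h1 := hform i (Finsupp.single j 1)
    have h2 := hform j (Finsupp.single i 1)
    rw [dotProduct_comm, h1, M.titsForm_comm] at h2
    change _ * c i = _ * c j at h2
    rw [h1]
    change _ = _ * (_ * (_ * c i))
    rcases eq_or_ne (M.titsForm (Finsupp.single j 1) (Finsupp.single i 1)) 0 with h0 | h0
    · rw [M.titsForm_comm, h0]; simp
    · have hij := mul_left_cancel₀ h0 h2
      have := (hsqpos i).ne'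
      rw [← hij]
      nth_rw 3 [← hsq i]
      field_simp
  let D : (B →₀ ℝ) →ₗ[ℝ] (B →₀ ℝ) :=
    Finsupp.linearCombination ℝ fun i => (√(c i))⁻¹ • Finsupp.single i 1
  have hD (i : B) (a : ℝ) : D (Finsupp.single i a) = (a * (√(c i))⁻¹) • Finsupp.single i 1 := by
    simp [D, mul_smul]
  have hDi (v : B →₀ ℝ) (i : B) : D v i = v i * (√(c i))⁻¹ := by
    induction v using Finsupp.induction_linear with
    | zero => simp
    | add v v' h h' => rw [map_add, Finsupp.add_apply, h, h', Finsupp.add_apply, add_mul]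
    | single j a =>
      rw [hD]
      rcases eq_or_ne j i with rfl | hji
      · simp
      · simp [hji]
  have hD0 {v : B →₀ ℝ} (h : D v = 0) : v = 0 := by
    ext i
    have := hDi v i
    rw [h] at this
    simpa [(hsqpos i).ne'] using this.symm
  have hmain (v w : B →₀ ℝ) : M.titsForm v w = Φ (D v) ⬝ᵥ Φ (D w) := by
    induction v using Finsupp.induction_linear with
    | zero => simp
    | add v v' h h' => simp only [map_add, LinearMap.add_apply, add_dotProduct, h, h']
    | single i a =>
      induction w using Finsupp.induction_linear with
      | zero => simp
      | add w w' h h' => simp only [map_add, dotProduct_add, h, h']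
      | single j b =>
        rw [hD, hD, ← mul_one a, ← mul_one b, ← smul_eq_mul, ← smul_eq_mul, ← Finsupp.smul_single,
          ← Finsupp.smul_single]
        simp only [map_smul, LinearMap.smul_apply, smul_eq_mul, hgram, smul_dotProduct,
          dotProduct_smul]
        ring
  rw [hmain]
  exact hpos fun h => hv (hD0 h)

end CoxeterSystem

/-! ### Positivity of roots and faithfulness. -/

namespace CoxeterSystem

variable {B W : Type*} [Group W] {M : CoxeterMatrix B}

/-- An entry `0` would give `cos (π / 0) = cos 0 = 1`, making `e i + e j` isotropic. -/
theorem coxeterMatrix_ne_zero [Finite W] (cs : CoxeterSystem M W) (i j : B) : M i j ≠ 0 := by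
  rcases eq_or_ne i j with rfl | hij
  · simp
  intro h0
  have hv : (Finsupp.single i 1 + Finsupp.single j 1 : B →₀ ℝ) ≠ 0 := by
    intro h
    have := DFunLike.congr_fun h i
    simp [hij] at this
  have h := cs.titsForm_self_pos hv
  have h0' : M j i = 0 := M.symmetric i j ▸ h0
  simp [CoxeterMatrix.titsForm_single_single, h0, h0'] at h

/-- The coefficients are `sin (a θ) / sin θ` with `θ = π / M i j` and `a ≤ M i j`, so `a θ` stays in
`[0, π]`. -/
theorem reflectionRep_alternatingWord_single [Finite W] (cs : CoxeterSystem M W) {i j : B}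
    (hij : i ≠ j) {k : ℕ} (hk : k < M i j) :
    ∃ p q : ℝ, 0 ≤ p ∧ 0 ≤ q ∧
      cs.reflectionRep (cs.wordProd (alternatingWord i j k)) (Finsupp.single i 1)
        = p • Finsupp.single i 1 + q • Finsupp.single j 1 := by
  have h1 := M.off_diagonal i j hij
  have hm2 : 2 ≤ M i j := by omega
  have hmR : (2 : ℝ) ≤ M i j := by exact_mod_cast hm2
  set θ : ℝ := Real.pi / (M i j : ℝ) with hθ
  have hmθ : (M i j : ℝ) * θ = Real.pi := by rw [hθ]; field_simp
  have hθ0 : 0 < θ := div_pos Real.pi_pos (by linarith)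
  have hsin : 0 < Real.sin θ := Real.sin_pos_of_pos_of_lt_pi hθ0 (by nlinarith)
  have hnonneg {a : ℕ} (ha : a ≤ M i j) : 0 ≤ Real.sin ((a : ℝ) * θ) / Real.sin θ := by
    have : (a : ℝ) ≤ M i j := by exact_mod_cast ha
    refine div_nonneg (Real.sin_nonneg_of_nonneg_of_le_pi (by positivity) ?_) hsin.le
    rw [← hmθ]
    gcongr
  have hyx : cs.reflectionRep (cs.simple j) (Finsupp.single i 1)
      = Finsupp.single i 1 + (2 * Real.cos θ) • Finsupp.single j 1 := by
    rw [reflectionRep_simple_single, M.symmetric]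
  have hpow (q : ℕ) : cs.reflectionRep ((cs.simple i * cs.simple j) ^ q) (Finsupp.single i 1)
      = (Real.sin ((2 * q + 1 : ℕ) * θ) / Real.sin θ) • Finsupp.single i 1
        + (Real.sin ((2 * q : ℕ) * θ) / Real.sin θ) • Finsupp.single j 1 := by
    have h := sin_smul_reflection_mul_reflection_pow (cs.reflectionRep_simple_single_self i)
      (cs.reflectionRep_simple_single i j) (cs.reflectionRep_simple_single_self j) hyx q
    rw [map_pow, map_mul]
    apply smul_right_injective _ hsin.ne'
    simp only [smul_add, smul_smul, mul_div_cancel₀ _ hsin.ne']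
    push_cast
    exact h
  rw [prod_alternatingWord_eq_mul_pow]
  rcases Nat.even_or_odd' k with ⟨q, rfl | rfl⟩
  · refine ⟨_, _, hnonneg (a := 2 * q + 1) hk, hnonneg (a := 2 * q) (by omega), ?_⟩
    simpa using hpow q
  · refine ⟨_, _, hnonneg (a := 2 * q + 1) hk.le, hnonneg (a := 2 * q + 2) hk, ?_⟩
    have e : (2 * q + 1) / 2 = q := by omega
    rw [if_neg (by simp), e, map_mul, Module.End.mul_apply, hpow, map_add, map_smul, map_smul, hyx,
      reflectionRep_simple_single_self]
    have e2 : (((2 * q + 2 : ℕ) : ℝ)) * θ = (2 * q + 1 : ℕ) * θ + θ := by push_cast; ring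
    have e3 : (((2 * q : ℕ) : ℝ)) * θ = (2 * q + 1 : ℕ) * θ - θ := by push_cast; ring
    rw [e2, e3, Real.sin_add, Real.sin_sub]
    module

theorem length_alternatingWord_le (cs : CoxeterSystem M W) (i j : B) (k : ℕ) :
    cs.length (cs.wordProd (alternatingWord i j k)) ≤ k :=
  (cs.length_wordProd_le _).trans_eq (length_alternatingWord i j k)

/-- Factor off the longest possible alternating right factor of `w`. -/
theorem exists_eq_mul_alternatingWord [Finite W] (cs : CoxeterSystem M W) {w : W} {i j : B}
    (hi : cs.length w < cs.length (w * cs.simple i))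
    (hj : cs.length (w * cs.simple j) < cs.length w) :
    ∃ v k, w = v * cs.wordProd (alternatingWord i j k) ∧ k < M i j ∧ cs.length v < cs.length w ∧
      cs.length v < cs.length (v * cs.simple i) ∧ cs.length v < cs.length (v * cs.simple j) := by
  classical
  let P : ℕ → Prop := fun k =>
    ∃ v, w = v * cs.wordProd (alternatingWord i j k) ∧ cs.length v + k = cs.length w
  have hP1 : P 1 := ⟨w * cs.simple j, by simp [alternatingWord], by
    rcases cs.length_mul_simple w j with h | h <;> omega⟩
  have hPend : ∃ n, ¬ P (n + 1) := ⟨cs.length w, fun ⟨v, _, h⟩ => by omega⟩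
  -- Taking the first failure makes `P` hold at every smaller positive length, in particular at `M i
  -- j` if that were reached.
  obtain ⟨n, hn, hmin⟩ : ∃ n, ¬ P (n + 1) ∧ ∀ k, k < n → P (k + 1) :=
    ⟨Nat.find hPend, Nat.find_spec hPend, fun k hk => not_not.mp (Nat.find_min hPend hk)⟩
  obtain ⟨n, rfl⟩ : ∃ n', n = n' + 1 := by
    cases n with
    | zero => exact absurd hP1 hn
    | succ n => exact ⟨n, rfl⟩
  obtain ⟨v, hv, hlen⟩ := hmin n (Nat.lt_succ_self n)
  -- At length `M i j` the braid relation rewrites the right factor to end in `i`, contradicting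
  -- that `i` is not a right descent of `w`.
  have hlt : n + 1 < M i j := by
    by_contra! hle
    obtain ⟨m, hm⟩ := Nat.exists_eq_succ_of_ne_zero (cs.coxeterMatrix_ne_zero i j)
    obtain ⟨u, hu, hul⟩ := hmin m (by omega)
    have hbraid := cs.wordProd_braidWord_eq i j
    rw [braidWord, braidWord, M.symmetric j i, hm, alternatingWord_succ j i,
      wordProd_concat] at hbraid
    have hwi : w * cs.simple i = u * cs.wordProd (alternatingWord i j m) := by
      rw [hu, ← Nat.succ_eq_add_one, hbraid, ← mul_assoc, simple_mul_simple_cancel_right]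
    rw [hwi] at hi
    have h1 := cs.length_mul_le u (cs.wordProd (alternatingWord i j m))
    have h2 := cs.length_alternatingWord_le i j m
    omega
  have hfirst : cs.length v < cs.length (v * cs.simple (if Even n then j else i)) := by
    rw [alternatingWord_succ', wordProd_cons, ← mul_assoc] at hv
    have h1 := cs.length_mul_le (v * cs.simple (if Even n then j else i))
      (cs.wordProd (alternatingWord i j n))
    have h2 := cs.length_alternatingWord_le i j n
    rw [← hv] at h1
    omega
  have hother : cs.length v < cs.length (v * cs.simple (if Even (n + 1) then j else i)) := by
    rcases cs.length_mul_simple v (if Even (n + 1) then j else i) with h | h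
    · omega
    · refine absurd ⟨v * cs.simple (if Even (n + 1) then j else i), ?_, by omega⟩ hn
      rw [alternatingWord_succ' i j (n + 1), wordProd_cons, ← mul_assoc,
        simple_mul_simple_cancel_right]
      exact hv
  refine ⟨v, n + 1, hv, hlt, by omega, ?_⟩
  by_cases hev : Even n
  · rw [if_pos hev] at hfirst
    rw [if_neg (by simpa [Nat.even_add_one] using hev)] at hother
    exact ⟨hother, hfirst⟩
  · rw [if_neg hev] at hfirst
    rw [if_pos (by simpa [Nat.even_add_one] using hev)] at hother
    exact ⟨hfirst, hother⟩

/-- Induction on length: split off a maximal alternating right factor in `i` and a right descent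
`j`. It sends `e i` to a nonnegative combination of `e i` and `e j`, and the shorter left factor has
neither as a descent. -/
theorem reflectionRep_single_nonneg [Finite W] (cs : CoxeterSystem M W) {w : W} {i : B}
    (hi : cs.length w < cs.length (w * cs.simple i)) (b : B) :
    0 ≤ cs.reflectionRep w (Finsupp.single i 1) b := by
  classical
  induction hn : cs.length w using Nat.strong_induction_on generalizing w i with
  | _ n ih =>
    subst hn
    rcases eq_or_ne w 1 with rfl | hw
    · rw [map_one, Module.End.one_apply, Finsupp.single_apply]
      split_ifs <;> norm_num
    obtain ⟨j, hj⟩ := cs.exists_rightDescent_of_ne_one hw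
    have hij : i ≠ j := by
      rintro rfl
      exact lt_asymm hi hj
    obtain ⟨v, k, hv, hk, hvw, hvi, hvj⟩ := cs.exists_eq_mul_alternatingWord hi hj
    obtain ⟨p, q, hp, hq, h⟩ := cs.reflectionRep_alternatingWord_single hij hk
    rw [hv, map_mul, Module.End.mul_apply, h, map_add, map_smul, map_smul]
    exact add_nonneg (mul_nonneg hp (ih _ hvw hvi rfl)) (mul_nonneg hq (ih _ hvw hvj rfl))

/-- The reflection representation is faithful. -/
theorem reflectionRep_injective [Finite W] (cs : CoxeterSystem M W) :
    Function.Injective cs.reflectionRep := by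
  rw [injective_iff_map_eq_one]
  intro w hw
  by_contra hne
  obtain ⟨i, hi⟩ := cs.exists_rightDescent_of_ne_one hne
  -- If `w` acted trivially, `w * cs.simple i` would send `e i` to `-e i`, although it does not have
  -- `i` as a right descent.
  have h := cs.reflectionRep_single_nonneg (w := w * cs.simple i) (i := i)
    (by rwa [simple_mul_simple_cancel_right]) i
  rw [map_mul, hw, one_mul, reflectionRep_simple_single_self] at h
  simp at h
  norm_num at h

/-! ### Angles between roots and linear independence. -/

/-- The vector `a` is a unit root of the element `t`, which acts as the reflection along `a`. -/
def IsUnitRoot (cs : CoxeterSystem M W) (t : W) (a : B →₀ ℝ) : Prop :=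
  M.titsForm a a = 1 ∧ ∀ v, cs.reflectionRep t v = v - (2 * M.titsForm a v) • a

theorem IsReflection.exists_isUnitRoot {cs : CoxeterSystem M W} {t : W} (ht : cs.IsReflection t) :
    ∃ a, cs.IsUnitRoot t a := by
  obtain ⟨w, i, rfl⟩ := ht
  refine ⟨cs.reflectionRep w (Finsupp.single i 1), ?_, fun v => ?_⟩
  · rw [titsForm_reflectionRep, M.titsForm_single_self]
  · have hv : cs.reflectionRep w (cs.reflectionRep w⁻¹ v) = v := by
      rw [← Module.End.mul_apply, ← map_mul, mul_inv_cancel, map_one, Module.End.one_apply]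
    nth_rw 3 [← hv]
    rw [titsForm_reflectionRep, map_mul, map_mul, Module.End.mul_apply, Module.End.mul_apply,
      reflectionRep_simple, map_sub, map_smul, hv]

/-- On the plane of the two roots, `s * t` rotates by `2θ` with `cos θ = -⟨a, b⟩`. Its `m`-th power
is trivial, so `θ = kπ/m` with `0 < k < m`. The absolute value is needed because the signs of the
roots are arbitrary. -/
theorem IsUnitRoot.abs_titsForm_le [Finite W] {cs : CoxeterSystem M W} {s t : W}
    {a b : B →₀ ℝ} (ha : cs.IsUnitRoot s a) (hb : cs.IsUnitRoot t b) (hst : s ≠ t) {m : ℕ}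
    (hm : m ≠ 0) (hpow : (s * t) ^ m = 1) :
    |M.titsForm a b| ≤ Real.cos (Real.pi / m) := by
  set c := M.titsForm a b with hc
  have hba : M.titsForm b a = c := M.titsForm_comm b a
  -- With `ε = ±1`: proportional unit roots give the same reflection, hence `s = t` by faithfulness.
  have hne (ε : ℝ) (hε : ε * ε = 1) : a - ε • b ≠ 0 := by
    intro h
    rw [sub_eq_zero] at h
    refine hst (cs.reflectionRep_injective (LinearMap.ext fun v => ?_))
    rw [ha.2, hb.2, h]
    simp only [map_smul, LinearMap.smul_apply, smul_eq_mul, smul_smul]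
    congr 2
    linear_combination (2 * M.titsForm b v) * hε
  have hexp (ε : ℝ) (hε : ε * ε = 1) : 0 < 2 - 2 * (ε * c) := by
    have h := cs.titsForm_self_pos (hne ε hε)
    simp only [map_sub, map_smul, LinearMap.sub_apply, LinearMap.smul_apply, smul_eq_mul, hba,
      ← hc, ha.1, hb.1] at h
    linear_combination h + hε
  have hc1 : c < 1 := by linarith [hexp 1 (by norm_num)]
  have hc2 : -1 < c := by linarith [hexp (-1) (by norm_num)]
  set θ := Real.arccos (-c) with hθ
  have hcos : Real.cos θ = -c := Real.cos_arccos (by linarith) (by linarith)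
  have hθ0 : 0 < θ := Real.arccos_pos.mpr (by linarith)
  have hθπ : θ < Real.pi := by
    refine lt_of_le_of_ne (Real.arccos_le_pi _) fun h => ?_
    rw [h, Real.cos_pi] at hcos
    linarith
  have hsin : 0 < Real.sin θ := Real.sin_pos_of_pos_of_lt_pi hθ0 hθπ
  have h := sin_smul_reflection_mul_reflection_pow (f := cs.reflectionRep s)
    (g := cs.reflectionRep t) (x := a) (y := b) (θ := θ) (by rw [ha.2, ha.1]; module)
    (by rw [ha.2, ← hc, hcos]; module) (by rw [hb.2, hb.1]; module)
    (by rw [hb.2, hba, hcos]; module) m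
  rw [← map_mul, ← map_pow, hpow, map_one, Module.End.one_apply] at h
  -- pair with `a - c b` and `b - c a` to separate the coefficients
  have hpa := congrArg (M.titsForm a) h
  have hpb := congrArg (M.titsForm b) h
  simp only [map_add, map_smul, smul_eq_mul, hba, ← hc, ha.1, hb.1] at hpa hpb
  have hdisc : 1 - c * c ≠ 0 := by nlinarith
  have hs1 : Real.sin ((2 * m : ℝ) * θ) = 0 := by
    refine (mul_eq_zero.mp (?_ : _ * (1 - c * c) = 0)).resolve_right hdisc
    linear_combination c * hpa - hpb
  have hs2 : Real.sin ((2 * m + 1 : ℝ) * θ) = Real.sin θ := by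
    rw [hs1] at hpa
    linarith
  have hc2m : Real.cos ((2 * m : ℝ) * θ) = 1 := by
    rw [add_mul, one_mul, Real.sin_add, hs1, zero_mul, zero_add] at hs2
    exact mul_right_cancel₀ hsin.ne' (by linarith)
  obtain ⟨k, hk⟩ := (Real.cos_eq_one_iff _).mp hc2m
  have hkm : (k : ℝ) * Real.pi = m * θ := by linarith
  have hm0 : (0 : ℝ) < m := by positivity
  have hπ := Real.pi_pos
  have hk0 : 0 < k := by
    have : (0 : ℝ) < k := by
      by_contra! hle
      nlinarith [mul_pos hm0 hθ0]
    exact_mod_cast this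
  have hklt : k < m := by
    have : (k : ℝ) < m := by
      by_contra! hle
      nlinarith
    exact_mod_cast this
  have hk1 : (1 : ℝ) ≤ k := by exact_mod_cast hk0
  have hk2 : (k : ℝ) ≤ m - 1 := by
    have : k ≤ (m : ℤ) - 1 := by omega
    exact_mod_cast this
  have hθeq : θ = k * (Real.pi / m) := by
    field_simp
    linarith
  have hd : 0 < Real.pi / m := by positivity
  have hmd : m * (Real.pi / m) = Real.pi := by field_simp
  have hlo : Real.pi / m ≤ θ := by rw [hθeq]; nlinarith
  have hhi : θ ≤ Real.pi - Real.pi / m := by rw [hθeq]; nlinarith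
  rw [abs_le]
  constructor
  · have := Real.cos_le_cos_of_nonneg_of_le_pi hd.le hθπ.le hlo
    linarith
  · have := Real.cos_le_cos_of_nonneg_of_le_pi hθ0.le (by linarith) hhi
    rw [Real.cos_pi_sub] at this
    linarith

end CoxeterSystem

namespace CoxeterMatrix

variable {B : Type*} (M : CoxeterMatrix B)

theorem titsForm_eq_sum (v : B →₀ ℝ) :
    M.titsForm v v
      = ∑ i ∈ v.support, ∑ j ∈ v.support, v i * v j * -Real.cos (Real.pi / (M i j : ℝ)) := by
  simp only [titsForm, Finsupp.linearCombination_apply, Finsupp.sum, LinearMap.sum_apply,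
    LinearMap.smul_apply, smul_eq_mul, Finset.mul_sum, mul_assoc]

end CoxeterMatrix

namespace CoxeterSystem

variable {B W : Type*} [Group W] {M : CoxeterMatrix B}

/-- Unit roots of reflections that form a Coxeter generating set are linearly independent. -/
theorem linearIndependent_of_isUnitRoot [Finite W] {cs : CoxeterSystem M W} {R : Subgroup W}
    {ι : Type*} {N : CoxeterMatrix ι} (ds : CoxeterSystem N R) {a : ι → B →₀ ℝ}
    (ha : ∀ i, cs.IsUnitRoot (ds.simple i : W) (a i)) : LinearIndependent ℝ a := by
  rw [linearIndependent_iff]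
  intro x hx
  by_contra hne
  -- Absolute values make every off-diagonal term of the canonical form of `N` at `y` at most the
  -- matching term of the Gram form at `x`. A relation `x` makes the latter total `0`, against
  -- positivity at `y`.
  let y : ι →₀ ℝ := x.mapRange abs abs_zero
  have hy : y ≠ 0 := by
    intro h
    refine hne (Finsupp.ext fun i => ?_)
    simpa [y] using DFunLike.congr_fun h i
  have hsupp : y.support = x.support := by
    ext i
    simp [y]
  have hpos := ds.titsForm_self_pos hy
  rw [N.titsForm_eq_sum, hsupp] at hpos
  have hzero : M.titsForm (Finsupp.linearCombination ℝ a x) (Finsupp.linearCombination ℝ a x)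
      = 0 := by
    rw [hx, map_zero]
  simp only [Finsupp.linearCombination_apply, Finsupp.sum, map_sum, LinearMap.sum_apply, map_smul,
    LinearMap.smul_apply, smul_eq_mul] at hzero
  refine absurd hpos (not_lt.mpr (le_of_le_of_eq ?_ hzero))
  rw [Finset.sum_comm]
  refine Finset.sum_le_sum fun i _ => ?_
  rw [Finset.mul_sum]
  refine Finset.sum_le_sum fun j _ => ?_
  change |x j| * |x i| * _ ≤ _
  rcases eq_or_ne i j with rfl | hij
  · rw [(ha i).1]
    simp [abs_mul_abs_self]
  · have hst : (ds.simple j : W) ≠ ds.simple i := fun h =>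
      hij (ds.simple_injective (Subtype.ext h)).symm
    have hpow : ((ds.simple j : W) * ds.simple i) ^ N j i = 1 := by
      exact_mod_cast congrArg Subtype.val (ds.simple_mul_simple_pow j i)
    have h := (ha j).abs_titsForm_le (ha i) hst (ds.coxeterMatrix_ne_zero j i) hpow
    have h1 : |x j| * |x i| * |M.titsForm (a j) (a i)|
        ≤ |x j| * |x i| * Real.cos (Real.pi / N j i) := by gcongr
    rw [← abs_mul, ← abs_mul] at h1
    have h2 := neg_abs_le (x j * x i * M.titsForm (a j) (a i))
    rw [← abs_mul]
    nlinarith [h1, h2]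

/-- A vector fixed by a product of reflections with linearly independent roots is fixed by each
factor. -/
theorem reflectionRep_eq_of_list_prod {cs : CoxeterSystem M W} {ι : Type*} {t : ι → W}
    {a : ι → B →₀ ℝ} (ha : ∀ i, cs.IsUnitRoot (t i) (a i)) (hli : LinearIndependent ℝ a)
    {l : List ι} (hl : l.Nodup) {v : B →₀ ℝ} (hv : cs.reflectionRep (l.map t).prod v = v) :
    ∀ i ∈ l, cs.reflectionRep (t i) v = v := by
  have hspan (l : List ι) (v : B →₀ ℝ) :
      cs.reflectionRep (l.map t).prod v - v ∈ Submodule.span ℝ (a '' {i | i ∈ l}) := by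
    induction l with
    | nil => simp
    | cons i l ih =>
      have hle : Submodule.span ℝ (a '' {j | j ∈ l}) ≤ Submodule.span ℝ (a '' {j | j ∈ i :: l}) :=
        Submodule.span_mono (Set.image_mono fun j hj => List.mem_cons_of_mem i hj)
      have hi : a i ∈ Submodule.span ℝ (a '' {j | j ∈ i :: l}) :=
        Submodule.subset_span ⟨i, by simp, rfl⟩
      rw [List.map_cons, List.prod_cons, map_mul, Module.End.mul_apply, (ha i).2, sub_right_comm]
      exact sub_mem (hle ih) (Submodule.smul_mem _ _ hi)
  induction l with
  | nil => simp
  | cons i l ih =>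
    rw [List.nodup_cons] at hl
    -- Moving the first reflection across, `t i v - v` is a multiple of `a i` lying in the span of
    -- the later roots, so it vanishes.
    have hinv : cs.reflectionRep (l.map t).prod v = cs.reflectionRep (t i) v := by
      have hsq : cs.reflectionRep (t i) (cs.reflectionRep (t i)
          (cs.reflectionRep (l.map t).prod v)) = cs.reflectionRep (l.map t).prod v := by
        rw [(ha i).2 (cs.reflectionRep (t i) _), (ha i).2]
        simp only [map_sub, map_smul, smul_eq_mul, (ha i).1]
        module
      rw [← hsq]
      congr 1
      rwa [List.map_cons, List.prod_cons, map_mul, Module.End.mul_apply] at hv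
    have hmem := hspan l v
    have hni := hli.notMem_span_image (s := {j | j ∈ l}) (x := i) hl.1
    rw [hinv, (ha i).2, sub_sub_cancel_left, Submodule.neg_mem_iff] at hmem
    have hcoef : 2 * M.titsForm (a i) v = 0 := by
      by_contra hne
      exact hni ((Submodule.smul_mem_iff _ hne).mp hmem)
    have hfix : cs.reflectionRep (t i) v = v := by rw [(ha i).2, hcoef, zero_smul, sub_zero]
    rw [List.forall_mem_cons]
    exact ⟨hfix, ih hl.2 (hinv.trans hfix)⟩

theorem mem_fixedSpace_of_isCoxeterElementOf [Finite W] {cs : CoxeterSystem M W}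
    {R : Subgroup W} {c : W} (hc : cs.IsCoxeterElementOf c R) {v : B →₀ ℝ}
    (hv : cs.reflectionRep c v = v) : v ∈ cs.fixedSpace (R : Set W) := by
  obtain ⟨l, hl, ⟨N, ds, hds⟩, hrefl, rfl⟩ := hc
  choose a ha using fun s : {r : R | r ∈ l} => (hrefl s s.2).exists_isUnitRoot
  have hli : LinearIndependent ℝ a :=
    linearIndependent_of_isUnitRoot ds fun s => by rw [hds]; exact ha s
  have hprod : (l.attach.map fun s : {r // r ∈ l} => ((s : R) : W)).prod = (l.prod : R) := by
    rw [← R.subtype_apply, map_list_prod]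
    congr 1
    exact List.attach_map_val (f := fun r : R => (r : W))
  rw [← hprod] at hv
  have hfix := reflectionRep_eq_of_list_prod (t := fun s : {r : R | r ∈ l} => ((s : R) : W)) ha hli
    (List.nodup_attach.mpr hl) hv
  intro x hx
  suffices h : ∀ r : R, cs.reflectionRep r v = v from h ⟨x, hx⟩
  intro r
  induction r using ds.simple_induction_left with
  | one => simp
  | mul_simple_left r s ih =>
    rw [Subgroup.coe_mul, map_mul, Module.End.mul_apply, ih, hds]
    exact hfix s (List.mem_attach _ _)

/-! ### Fixed spaces and parabolic closures. -/

/-- Every vector fixed by `x ∈ R` differs from a vector fixed by `R` by a vector which is fixed by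
`x` and orthogonal to the vectors fixed by `R`. -/
theorem exists_sub_mem_orthogonal_fixedSpace [Finite W] (cs : CoxeterSystem M W) (R : Subgroup W)
    (v : B →₀ ℝ) : ∃ p ∈ cs.fixedSpace (R : Set W),
      v - p ∈ M.titsForm.orthogonal (cs.fixedSpace (R : Set W)) := by
  have := Fintype.ofFinite R
  have hcard : (Fintype.card R : ℝ) ≠ 0 := by simp
  -- The average of `v` over `R`: pairing with an `R`-fixed vector does not distinguish `v` from its
  -- translates.
  refine ⟨(Fintype.card R : ℝ)⁻¹ • ∑ r : R, cs.reflectionRep r v, fun x hx => ?_, fun u hu => ?_⟩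
  · rw [map_smul, map_sum]
    congr 1
    refine Fintype.sum_equiv (Equiv.mulLeft ⟨x, hx⟩) _ _ fun r => ?_
    simp
  · have h (r : R) : M.titsForm u (cs.reflectionRep r v) = M.titsForm u v := by
      conv_lhs => rw [← hu r r.2]
      exact cs.titsForm_reflectionRep r u v
    simp [h, hcard]

theorem parabolicClosure_singleton_eq [Finite W] (cs : CoxeterSystem M W) {R : Subgroup W} {x : W}
    (hx : x ∈ R) (h : ∀ P : Subgroup W, cs.IsParabolicSubgroupOf P R → P ≠ R → x ∉ P) :
    cs.parabolicClosure {x} = cs.parabolicClosure (R : Set W) := by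
  have hle : cs.fixedSpace (R : Set W) ≤ cs.fixedSpace {x} := by
    rintro v hv _ rfl
    exact hv _ hx
  set U := M.titsForm.orthogonal (cs.fixedSpace (R : Set W)) ⊓ cs.fixedSpace {x} with hU
  have hP : R ⊓ cs.parabolicSubgroup U = R := by
    by_contra hne
    exact h _ ⟨U, inf_le_left, rfl⟩ hne ⟨hx, fun u hu => hu.2 x rfl⟩
  have hUR : U ≤ cs.fixedSpace (R : Set W) := fun u hu r hr => (inf_eq_left.mp hP hr) u hu
  unfold parabolicClosure
  congr 1
  refine le_antisymm (fun v hv => ?_) hle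
  obtain ⟨p, hp, hvp⟩ := cs.exists_sub_mem_orthogonal_fixedSpace R v
  have hmem := hUR ⟨hvp, sub_mem hv (hle hp)⟩
  simpa using add_mem hmem hp

theorem exists_map_conj_le_parabolicSubgroup [Finite W] (cs : CoxeterSystem M W) {R : Subgroup W}
    {V : Submodule ℝ (B →₀ ℝ)} {c : W} (hc : cs.IsCoxeterElementOf c R)
    (hconj : ∃ d ∈ cs.parabolicSubgroup V, IsConj c d) :
    ∃ w : W, R.map (MulAut.conj w⁻¹).toMonoidHom ≤ cs.parabolicSubgroup V := by
  obtain ⟨d, hd, hcd⟩ := hconj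
  obtain ⟨w, rfl⟩ := isConj_iff.mp hcd
  -- Since `w * c * w⁻¹` fixes `V` pointwise, `c`, and hence `R`, fixes `w⁻¹ V` pointwise. The
  -- conjugation in the goal inverts its witness.
  refine ⟨w⁻¹, ?_⟩
  rintro _ ⟨r, hr, rfl⟩ v hv
  have hinv (g : W) : cs.reflectionRep (w * g * w⁻¹) v = v ↔
      cs.reflectionRep g (cs.reflectionRep w⁻¹ v) = cs.reflectionRep w⁻¹ v := by
    rw [map_mul, map_mul, Module.End.mul_apply, Module.End.mul_apply]
    have h1 (u : B →₀ ℝ) : cs.reflectionRep w (cs.reflectionRep w⁻¹ u) = u := by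
      simp [← Module.End.mul_apply, ← map_mul]
    have h2 (u : B →₀ ℝ) : cs.reflectionRep w⁻¹ (cs.reflectionRep w u) = u := by
      simp [← Module.End.mul_apply, ← map_mul]
    exact ⟨fun h => by rw [← h2 (cs.reflectionRep g _), h], fun h => by rw [h, h1]⟩
  have hfix := mem_fixedSpace_of_isCoxeterElementOf hc ((hinv c).mp (hd v hv))
  simpa using (hinv r).mpr (hfix r hr)

end CoxeterSystem

theorem lemma2p2 {B W : Type*} [Group W] [Finite W] {M : CoxeterMatrix B}
    (cs : CoxeterSystem M W) (R : Subgroup W) (hR : cs.IsReflectionSubgroup R) :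
    (∀ x ∈ R,
      (∀ P : Subgroup W, cs.IsParabolicSubgroupOf P R → P ≠ R → x ∉ P) →
        cs.parabolicClosure {x} = cs.parabolicClosure (R : Set W)) ∧
    (∀ (V : Submodule ℝ (B →₀ ℝ)) (c : W), cs.IsCoxeterElementOf c R →
      (∃ d ∈ cs.parabolicSubgroup V, IsConj c d) →
        ∃ w : W, R.map (MulAut.conj w⁻¹).toMonoidHom ≤ cs.parabolicSubgroup V) :=
  ⟨fun _ hx h => cs.parabolicClosure_singleton_eq hx h,
    fun _ _ hc h => cs.exists_map_conj_le_parabolicSubgroup hc h⟩
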